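/- Let $N\ge 1$, let $(\Omega,\mathcal F,\mathbb P)$ be a probability space, and let $L^\infty(\mathbb R^N)$ be the space of essentially bounded $N$-dimensional random vectors modulo almost sure equality, ordered componentwise almost surely. Lower semicontinuity on $L^\infty(\mathbb R^N)$ and $L^\infty(\mathbb R)$ refers to the weak* topologies induced by $L^1(\mathbb R^N)$ and $L^1(\mathbb R)$; an $\mathbb R^N$-valued functional is lower semicontinuous if each of its components is. For $C\subseteq\mathbb R^N$ let $\operatorname{recc} C=\{y\in\mathbb R^N : \lambda y+C\subseteq C\ \text{for all}\ \lambda>0\}$, and let $\mathcal J$ be the set of closed convex sets $C\subseteq\mathbb R^N$ with $\operatorname{recc} C=\mathbb R^N_+$. Let $R$ assign to every $X\in L^\infty(\mathbb R^N)$ a set $R(X)\subseteq\mathbb R^N$, and suppose that $R$ is a convex set-valued risk measure, that is, for all $X,Y\in L^\infty(\mathbb R^N)$, $m\in\mathbb R^N$ and $\lambda\in(0,1)$: - (monotonicity) $X\ge Y$ implies $R(X)\supseteq R(Y)$; - (cash-additivity) $R(X+m)=R(X)-m$; - (finiteness at zero) $R(0)\notin\{\emptyset,\mathbb R^N\}$;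 - (convexity) $R(\lambda X+(1-\lambda)Y)\supseteq\lambda R(X)+(1-\lambda)R(Y)$. Then the following three properties are equivalent: 1. (vector-basedness) there are a lower semicontinuous $r\colon L^\infty(\mathbb R^N)\to\mathbb R^N$ and $C\in\mathcal J$ such that $R(X)=r(X)+C$ for all $X\in L^\infty(\mathbb R^N)$; 2. (separability) there are set-valued functionals $\bar R_1,\dots,\bar R_N$ from $L^\infty(\mathbb R)$ to subsets of $\mathbb R$ with nonempty compact values, such that each $\min\bar R_i\colon L^\infty(\mathbb R)\to\mathbb R$ is lower semicontinuous, and $C\in\mathcal J$ such that $R(X)=\bar R_1(X_1)\times\dots\times\bar R_N(X_N)+C$ for all $X\in L^\infty(\mathbb R^N)$; 3. (strong separability) there are lower semicontinuous $\bar r_1,\dots,\bar r_N\colon L^\infty(\mathbb R)\to\mathbb R$ and $C\in\mathcal J$ such that $R(X)=(\bar r_1(X_1),\dots,\bar r_N(X_N))^\top+C$ for all $X\in L^\infty(\mathbb R^N)$. If they hold, then $R$ is closed: its graph $\{(X,m)\in L^\infty(\mathbb R^N)\times\mathbb R^N : m\in R(X)\}$ is closed in the product of the weak* topology on $L^\infty(\mathbb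 R^N)$ and the usual topology on $\mathbb R^N$. -/

import Mathlib

open MeasureTheory Set
open scoped ENNReal Pointwise

/-- `L^∞(ℝ)` over the measure space `(Ω, μ)`. -/
abbrev LInf {Ω : Type*} [MeasurableSpace Ω] (μ : Measure Ω) : Type _ :=
  Lp ℝ ∞ μ

/-- `L^∞(ℝ^N)`: essentially bounded `N`-dimensional random vectors up to a.s. equality. -/
abbrev LInfVec {Ω : Type*} [MeasurableSpace Ω] (μ : Measure Ω) (N : ℕ) : Type _ :=
  Lp (Fin N → ℝ) ∞ μ

namespace RiskMeasure

variable {Ω : Type*} [MeasurableSpace Ω] {μ : Measure Ω} {N : ℕ}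

/-- The weak* topology on `L^∞(ℝ)`: the coarsest topology making `X ↦ E[U X]` continuous
for every `U ∈ L^1(ℝ)`. -/
@[reducible]
noncomputable def weakStar (μ : Measure Ω) : TopologicalSpace (LInf μ) :=
  TopologicalSpace.induced (fun (X : LInf μ) (U : Lp ℝ 1 μ) => ∫ ω, U ω * X ω ∂μ)
    Pi.topologicalSpace

/-- The weak* topology on `L^∞(ℝ^N)`: the coarsest topology making `X ↦ E[Uᵀ X]` continuous
for every `U ∈ L^1(ℝ^N)`. -/
@[reducible]
noncomputable def weakStarVec (μ : Measure Ω) (N : ℕ) : TopologicalSpace (LInfVec μ N) :=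
  TopologicalSpace.induced
    (fun (X : LInfVec μ N) (U : Lp (Fin N → ℝ) 1 μ) => ∫ ω, U ω ⬝ᵥ X ω ∂μ)
    Pi.topologicalSpace

/-- Lower semicontinuity of a real functional on `L^∞(ℝ)` for the weak* topology. -/
def WeakStarLSC (f : LInf μ → ℝ) : Prop :=
  @LowerSemicontinuous (LInf μ) ℝ (weakStar μ) _ f

/-- Lower semicontinuity of a real functional on `L^∞(ℝ^N)` for the weak* topology. -/
def WeakStarLSCVec (f : LInfVec μ N → ℝ) : Prop :=
  @LowerSemicontinuous (LInfVec μ N) ℝ (weakStarVec μ N) _ f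

/-- The `i`-th component `X_i ∈ L^∞(ℝ)` of a random vector `X ∈ L^∞(ℝ^N)`. -/
noncomputable def component (X : LInfVec μ N) (i : Fin N) : LInf μ :=
  (ContinuousLinearMap.proj (R := ℝ) (φ := fun _ : Fin N => ℝ) i).compLp X

/-- The recession cone `{y | ∀ t > 0, t y + C ⊆ C}`. -/
def recessionCone (C : Set (Fin N → ℝ)) : Set (Fin N → ℝ) :=
  {y | ∀ t : ℝ, 0 < t → (t • y) +ᵥ C ⊆ C}

/-- Closed convex sets `C ⊆ ℝ^N` whose recession cone is the nonnegative orthant. -/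
def orthantSets (N : ℕ) : Set (Set (Fin N → ℝ)) :=
  {C | IsClosed C ∧ Convex ℝ C ∧ recessionCone C = {x | 0 ≤ x}}

/-- A set-valued risk measure on `L^∞(ℝ^N)`. -/
structure IsSetValuedRiskMeasure [IsFiniteMeasure μ]
    (R : LInfVec μ N → Set (Fin N → ℝ)) : Prop where
  monotone : ∀ X Y : LInfVec μ N, (∀ᵐ ω ∂μ, Y ω ≤ X ω) → R Y ⊆ R X
  cash_additive : ∀ (X : LInfVec μ N) (m : Fin N → ℝ),
    R (X + Lp.const ∞ μ m) = (-m) +ᵥ R X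
  finite_at_zero : R 0 ≠ ∅ ∧ R 0 ≠ univ

/-- Convexity of a set-valued functional. -/
def IsConvex (R : LInfVec μ N → Set (Fin N → ℝ)) : Prop :=
  ∀ (X Y : LInfVec μ N) (t : ℝ), 0 < t → t < 1 →
    t • R X + (1 - t) • R Y ⊆ R (t • X + (1 - t) • Y)

/-- The graph is closed for the product of the weak* topology and the usual topology. -/
def HasClosedGraph (R : LInfVec μ N → Set (Fin N → ℝ)) : Prop :=
  @IsClosed (LInfVec μ N × (Fin N → ℝ))
    (@instTopologicalSpaceProd _ _ (weakStarVec μ N) inferInstance)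
    {p | p.2 ∈ R p.1}

/-- `R(X) = r(X) + C` with `r` (componentwise) weak* lower semicontinuous. -/
def IsVectorBased (R : LInfVec μ N → Set (Fin N → ℝ)) : Prop :=
  ∃ r : LInfVec μ N → (Fin N → ℝ), ∃ C ∈ orthantSets N,
    (∀ i, WeakStarLSCVec fun X => r X i) ∧ ∀ X, R X = r X +ᵥ C

/-- `R(X) = R₁(X₁) × ⋯ × R_N(X_N) + C`, where the `R_i` have nonempty compact values and
`min R_i` (the infimum, attained by compactness) is weak* lower semicontinuous. -/
def IsSeparable (R : LInfVec μ N → Set (Fin N → ℝ)) : Prop :=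
  ∃ Rbar : Fin N → LInf μ → Set ℝ, ∃ C ∈ orthantSets N,
    (∀ i Y, (Rbar i Y).Nonempty ∧ IsCompact (Rbar i Y)) ∧
    (∀ i, WeakStarLSC fun Y => sInf (Rbar i Y)) ∧
    ∀ X, R X = (univ.pi fun i => Rbar i (component X i)) + C

/-- `R(X) = (r₁(X₁), …, r_N(X_N)) + C` with every `r_i` weak* lower semicontinuous. -/
def IsStronglySeparable (R : LInfVec μ N → Set (Fin N → ℝ)) : Prop :=
  ∃ rbar : Fin N → LInf μ → ℝ, ∃ C ∈ orthantSets N,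
    (∀ i, WeakStarLSC (rbar i)) ∧
    ∀ X, R X = (fun i => rbar i (component X i)) +ᵥ C

end RiskMeasure

/-! Since the recession cone of `C` is exactly the nonnegative orthant, `v + C ⊆ w + C` forces `w ≤
v`. Hence in `R = r + C` the monotonicity and cash-additivity of `R` pass to `r`. They make `r`
separate into coordinates (`apply_eq_apply_embed_component`): changing the components of `X` other
than the `i`-th can be dominated, both ways, by adding cash in those coordinates only, which leaves
`r X i` unchanged. Compact factors reduce to their minima because `C` absorbs the excess.
Semicontinuity is carried along by the weak* continuous maps `component` and `embed`. -/

namespace RiskMeasure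

section Orthant

variable {N : ℕ} {C : Set (Fin N → ℝ)}

theorem add_mem_of_mem_orthantSets (hC : C ∈ orthantSets N) {c y : Fin N → ℝ}
    (hc : c ∈ C) (hy : 0 ≤ y) : y + c ∈ C := by
  have hmem : y ∈ recessionCone C := by rw [hC.2.2]; exact hy
  have h := hmem 1 one_pos ⟨c, hc, rfl⟩
  simpa using h

theorem mem_of_le_of_mem_orthantSets (hC : C ∈ orthantSets N) {c y : Fin N → ℝ}
    (hc : c ∈ C) (hy : c ≤ y) : y ∈ C := by
  have h := add_mem_of_mem_orthantSets hC hc (sub_nonneg.2 hy)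
  simpa using h

theorem nsmul_add_mem {d : Fin N → ℝ} (hd : ∀ c ∈ C, d + c ∈ C) (n : ℕ) {c : Fin N → ℝ}
    (hc : c ∈ C) : (n : ℝ) • d + c ∈ C := by
  induction n with
  | zero => simpa using hc
  | succ n ih =>
    have h := hd _ ih
    have e : d + ((n : ℝ) • d + c) = ((n + 1 : ℕ) : ℝ) • d + c := by
      push_cast; module
    rwa [e] at h

/-- A translation mapping a convex set into itself is along a recession direction. -/
theorem mem_recessionCone_of_add_mem (hC : Convex ℝ C) {d : Fin N → ℝ}
    (hd : ∀ c ∈ C, d + c ∈ C) : d ∈ recessionCone C := by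
  rintro t ht _ ⟨c, hc, rfl⟩
  -- For an integer `n > t`, the point `t • d + c` lies on the segment from `c` to `n • d + c`, both
  -- in `C`.
  obtain ⟨n, hn⟩ := exists_nat_gt t
  have hn0 : (0 : ℝ) < n := ht.trans hn
  have hle : t / n ≤ 1 := (div_le_one hn0).2 hn.le
  have h := hC hc (nsmul_add_mem hd n hc) (sub_nonneg.2 hle) (div_nonneg ht.le hn0.le)
    (sub_add_cancel _ _)
  have e : (1 - t / n) • c + (t / n) • ((n : ℝ) • d + c) = t • d + c := by
    rw [smul_add, smul_smul, div_mul_cancel₀ _ hn0.ne']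
    module
  rw [e] at h
  exact h

/-- Translation by `v - w` maps `C` into itself, so `v - w` is a recession direction and therefore
nonnegative. -/
theorem le_of_vadd_subset_vadd (hC : C ∈ orthantSets N) {v w : Fin N → ℝ}
    (h : v +ᵥ C ⊆ w +ᵥ C) : w ≤ v := by
  have hd : v - w ∈ recessionCone C := by
    refine mem_recessionCone_of_add_mem hC.2.1 fun c hc => ?_
    obtain ⟨c', hc', e⟩ := h ⟨c, hc, rfl⟩
    have e' : w + c' = v + c := e
    have : v - w + c = c' := by rw [sub_add_eq_add_sub, ← e']; abel
    rwa [this]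
  rw [hC.2.2] at hd
  exact sub_nonneg.1 hd

theorem eq_of_vadd_eq_vadd (hC : C ∈ orthantSets N) {v w : Fin N → ℝ}
    (h : v +ᵥ C = w +ᵥ C) : v = w :=
  le_antisymm (le_of_vadd_subset_vadd hC h.ge) (le_of_vadd_subset_vadd hC h.le)

end Orthant

variable {Ω : Type*} [MeasurableSpace Ω] {μ : Measure Ω} {N : ℕ}

/-- The random vector with `i`-th component `Y` and all other components zero. -/
noncomputable def embed (i : Fin N) (Y : LInf μ) : LInfVec μ N :=
  (ContinuousLinearMap.single ℝ (fun _ : Fin N => ℝ) i).compLp Y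

theorem component_ae (X : LInfVec μ N) (i : Fin N) :
    ∀ᵐ ω ∂μ, component X i ω = X ω i :=
  ContinuousLinearMap.coeFn_compLp _ X

theorem single_compLp_ae {p : ℝ≥0∞} (i : Fin N) (Y : Lp ℝ p μ) :
    ∀ᵐ ω ∂μ, (ContinuousLinearMap.single ℝ (fun _ : Fin N => ℝ) i).compLp Y ω =
      Pi.single i (Y ω) :=
  ContinuousLinearMap.coeFn_compLp _ Y

theorem embed_ae (i : Fin N) (Y : LInf μ) :
    ∀ᵐ ω ∂μ, embed i Y ω = Pi.single i (Y ω) :=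
  single_compLp_ae i Y

theorem continuous_weakStar_pairing (U : Lp ℝ 1 μ) :
    @Continuous _ _ (weakStar μ) _ fun Y : LInf μ => ∫ ω, U ω * Y ω ∂μ := by
  let _ := weakStar μ
  have h : Continuous fun (Y : LInf μ) (V : Lp ℝ 1 μ) => ∫ ω, V ω * Y ω ∂μ :=
    continuous_induced_dom
  exact (continuous_pi_iff.1 h) U

theorem continuous_weakStarVec_pairing (U : Lp (Fin N → ℝ) 1 μ) :
    @Continuous _ _ (weakStarVec μ N) _ fun X : LInfVec μ N => ∫ ω, U ω ⬝ᵥ X ω ∂μ := by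
  let _ := weakStarVec μ N
  have h : Continuous fun (X : LInfVec μ N) (V : Lp (Fin N → ℝ) 1 μ) => ∫ ω, V ω ⬝ᵥ X ω ∂μ :=
    continuous_induced_dom
  exact (continuous_pi_iff.1 h) U

/-- Pairing `U` with the `i`-th component of `X` is pairing `X` with the integrable vector that has
`U` in coordinate `i` and zeros elsewhere. -/
theorem continuous_weakStar_component (i : Fin N) :
    @Continuous _ _ (weakStarVec μ N) (weakStar μ) fun X : LInfVec μ N => component X i := by
  let _ := weakStarVec μ N
  refine continuous_induced_rng.2 (continuous_pi fun U => ?_)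
  have h : Continuous fun X : LInfVec μ N =>
      ∫ ω, ((ContinuousLinearMap.single ℝ (fun _ : Fin N => ℝ) i).compLp U) ω ⬝ᵥ X ω ∂μ :=
    continuous_weakStarVec_pairing _
  refine h.congr fun X => integral_congr_ae ?_
  filter_upwards [single_compLp_ae i U, component_ae X i] with ω h₁ h₂
  rw [h₁, h₂, single_dotProduct]

/-- Dually, pairing `U` with `embed i Y` only sees the `i`-th coordinate of `U`. -/
theorem continuous_weakStar_embed (i : Fin N) :
    @Continuous _ _ (weakStar μ) (weakStarVec μ N) (embed i : LInf μ → LInfVec μ N) := by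
  let _ := weakStar μ
  refine continuous_induced_rng.2 (continuous_pi fun U => ?_)
  have h : Continuous fun Y : LInf μ =>
      ∫ ω, ((ContinuousLinearMap.proj (R := ℝ) (φ := fun _ : Fin N => ℝ) i).compLp U) ω * Y ω ∂μ :=
    continuous_weakStar_pairing _
  refine h.congr fun Y => integral_congr_ae ?_
  filter_upwards [embed_ae i Y, ContinuousLinearMap.coeFn_compLp
    (ContinuousLinearMap.proj (R := ℝ) (φ := fun _ : Fin N => ℝ) i) U] with ω h₁ h₂
  rw [h₁, h₂, dotProduct_single]
  rfl

theorem WeakStarLSC.comp_component {f : LInf μ → ℝ} (hf : WeakStarLSC f) (i : Fin N) :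
    WeakStarLSCVec fun X : LInfVec μ N => f (component X i) := by
  intro X y hy
  exact (@Continuous.tendsto _ _ (weakStarVec μ N) (weakStar μ) _
    (continuous_weakStar_component i) X).eventually (hf (component X i) y hy)

theorem WeakStarLSCVec.comp_embed {f : LInfVec μ N → ℝ} (hf : WeakStarLSCVec f) (i : Fin N) :
    WeakStarLSC fun Y : LInf μ => f (embed i Y) := by
  intro Y y hy
  exact (@Continuous.tendsto _ _ (weakStar μ) (weakStarVec μ N) _
    (continuous_weakStar_embed i) Y).eventually (hf (embed i Y) y hy)

theorem ae_norm_le_norm (X : LInfVec μ N) : ∀ᵐ ω ∂μ, ‖X ω‖ ≤ ‖X‖ := by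
  filter_upwards [ae_le_eLpNormEssSup (f := X) (μ := μ)] with ω hω
  rw [← eLpNorm_exponent_top] at hω
  rw [Lp.norm_def, ← toReal_enorm]
  exact ENNReal.toReal_mono (Lp.eLpNorm_ne_top X) hω

/-- A monotone, cash-additive vector functional has an `i`-th component depending only on the
`i`-th component of its argument: the others lie between two deterministic shifts. -/
theorem apply_eq_apply_embed_component [IsFiniteMeasure μ] {r : LInfVec μ N → Fin N → ℝ}
    (hmono : ∀ X Y : LInfVec μ N, (∀ᵐ ω ∂μ, Y ω ≤ X ω) → r X ≤ r Y)
    (hcash : ∀ (X : LInfVec μ N) (m : Fin N → ℝ), r (X + Lp.const ∞ μ m) = -m + r X)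
    (X : LInfVec μ N) (i : Fin N) : r X i = r (embed i (component X i)) i := by
  set E := embed i (component X i) with hE
  -- The entry `0` at `i` keeps the cash shift invisible to coordinate `i`; the entries `‖X‖`
  -- elsewhere give both `X ≤ E + m` and `E ≤ X + m` almost surely.
  set m : Fin N → ℝ := Function.update (fun _ => ‖X‖) i 0 with hm
  have hadd (Z : LInfVec μ N) : ∀ᵐ ω ∂μ, (Z + Lp.const ∞ μ m) ω = Z ω + m := by
    filter_upwards [Lp.coeFn_add Z (Lp.const ∞ μ m), Lp.coeFn_const (p := ∞) (μ := μ) m]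
      with ω h₁ h₂
    rw [h₁, Pi.add_apply, h₂, Function.const_apply]
  have hval : ∀ᵐ ω ∂μ, E ω = Pi.single i (X ω i) := by
    filter_upwards [embed_ae i (component X i), component_ae X i] with ω h₁ h₂
    rw [hE, h₁, h₂]
  have hcoord : ∀ᵐ ω ∂μ, ∀ j, |X ω j| ≤ ‖X‖ := by
    filter_upwards [ae_norm_le_norm X] with ω hω j
    exact (norm_le_pi_norm (X ω) j).trans hω
  have h₁ : r (E + Lp.const ∞ μ m) ≤ r X := by
    refine hmono _ _ ?_
    filter_upwards [hadd E, hval, hcoord] with ω ha hv hc j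
    rw [ha, hv]
    rcases eq_or_ne j i with rfl | hj
    · simp [hm]
    · simpa [hm, hj] using (abs_le.1 (hc j)).2
  have h₂ : r (X + Lp.const ∞ μ m) ≤ r E := by
    refine hmono _ _ ?_
    filter_upwards [hadd X, hval, hcoord] with ω ha hv hc j
    rw [ha, hv]
    rcases eq_or_ne j i with rfl | hj
    · simp [hm]
    · have := (abs_le.1 (hc j)).1
      simp only [hm, Pi.add_apply, Pi.single_eq_of_ne hj, Function.update_of_ne hj]
      linarith
  rw [hcash] at h₁ h₂
  refine le_antisymm ?_ ?_
  · simpa [hm] using h₂ i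
  · simpa [hm] using h₁ i

theorem IsVectorBased.isStronglySeparable [IsFiniteMeasure μ] {R : LInfVec μ N → Set (Fin N → ℝ)}
    (hR : IsSetValuedRiskMeasure R) (h : IsVectorBased R) : IsStronglySeparable R := by
  obtain ⟨r, C, hC, hlsc, hrep⟩ := h
  have hmono (X Y : LInfVec μ N) (hXY : ∀ᵐ ω ∂μ, Y ω ≤ X ω) : r X ≤ r Y := by
    have := hR.monotone X Y hXY
    rw [hrep, hrep] at this
    exact le_of_vadd_subset_vadd hC this
  have hcash (X : LInfVec μ N) (m : Fin N → ℝ) : r (X + Lp.const ∞ μ m) = -m + r X := by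
    have := hR.cash_additive X m
    rw [hrep, hrep, vadd_vadd] at this
    exact eq_of_vadd_eq_vadd hC this
  refine ⟨fun i Y => r (embed i Y) i, C, hC, fun i => (hlsc i).comp_embed i, fun X => ?_⟩
  rw [hrep]
  congr 1
  exact funext (apply_eq_apply_embed_component hmono hcash X)

theorem IsStronglySeparable.isVectorBased {R : LInfVec μ N → Set (Fin N → ℝ)}
    (h : IsStronglySeparable R) : IsVectorBased R := by
  obtain ⟨rbar, C, hC, hlsc, hrep⟩ := h
  exact ⟨fun X i => rbar i (component X i), C, hC, fun i => (hlsc i).comp_component i, hrep⟩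

theorem IsStronglySeparable.isSeparable {R : LInfVec μ N → Set (Fin N → ℝ)}
    (h : IsStronglySeparable R) : IsSeparable R := by
  obtain ⟨rbar, C, hC, hlsc, hrep⟩ := h
  refine ⟨fun i Y => {rbar i Y}, C, hC, fun i Y => ⟨singleton_nonempty _, isCompact_singleton⟩,
    fun i => by simpa using hlsc i, fun X => ?_⟩
  rw [hrep, univ_pi_singleton, singleton_add]
  rfl

/-- Each compact factor may be replaced by its minimum, since `C` absorbs the orthant. -/
theorem IsSeparable.isStronglySeparable {R : LInfVec μ N → Set (Fin N → ℝ)}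
    (h : IsSeparable R) : IsStronglySeparable R := by
  obtain ⟨Rbar, C, hC, hcomp, hlsc, hrep⟩ := h
  refine ⟨fun i Y => sInf (Rbar i Y), C, hC, hlsc, fun X => ?_⟩
  rw [hrep]
  apply Subset.antisymm
  · rintro _ ⟨v, hv, c, hc, rfl⟩
    set s : Fin N → ℝ := fun i => sInf (Rbar i (component X i)) with hs
    have hle : s ≤ v := fun i => csInf_le (hcomp i _).2.bddBelow (hv i (mem_univ i))
    refine ⟨v - s + c, add_mem_of_mem_orthantSets hC hc (sub_nonneg.2 hle), ?_⟩
    change s + (v - s + c) = v + c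
    abel
  · rintro _ ⟨c, hc, rfl⟩
    exact ⟨_, fun i _ => (hcomp i _).2.sInf_mem (hcomp i _).1, c, hc, rfl⟩

/-- The complement of the graph is open: a point outside the closed set `C` stays outside after a
small upward shift, and since `C` is upward closed, everything below the shifted point is outside
too. Lower semicontinuity of `r` is what bounds `m' - r X'` from above near `(X, m)`. -/
theorem IsVectorBased.hasClosedGraph {R : LInfVec μ N → Set (Fin N → ℝ)}
    (h : IsVectorBased R) : HasClosedGraph R := by
  obtain ⟨r, C, hC, hlsc, hrep⟩ := h
  let _ := weakStarVec μ N
  have hmem (X : LInfVec μ N) (m : Fin N → ℝ) : m ∈ R X ↔ m - r X ∈ C := by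
    rw [hrep, mem_vadd_set_iff_neg_vadd_mem, vadd_eq_add, neg_add_eq_sub]
  refine isOpen_compl_iff.1 (isOpen_iff_mem_nhds.2 ?_)
  rintro ⟨X, m⟩ hXm
  have hout : m - r X ∉ C := fun hc => hXm ((hmem X m).2 hc)
  have hcont : Filter.Tendsto (fun e : ℝ => m - r X + fun _ => e) (nhdsWithin 0 (Ioi 0))
      (nhds (m - r X)) := by
    have : Continuous fun e : ℝ => m - r X + fun _ => e := by fun_prop
    have ht := this.tendsto 0
    have e0 : (m - r X + fun _ => (0 : ℝ)) = m - r X := by ext; simp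
    rw [e0] at ht
    exact ht.mono_left nhdsWithin_le_nhds
  obtain ⟨e, he, hepos⟩ := ((hcont.eventually (hC.1.isOpen_compl.mem_nhds hout)).and
    self_mem_nhdsWithin).exists
  have hepos : 0 < e := hepos
  -- The shift `e` is split evenly between the decrease of `r` and the increase of `m`.
  have hX : ∀ᶠ X' in nhds X, ∀ i, r X i - e / 2 < r X' i :=
    Filter.eventually_all.2 fun i => hlsc i X _ (by linarith)
  have hm : ∀ᶠ m' in nhds m, ∀ i, m' i < m i + e / 2 :=
    Filter.eventually_all.2 fun i =>
      ((continuous_apply i).tendsto m).eventually (gt_mem_nhds (by linarith))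
  have hprod := hX.prod_nhds hm
  refine Filter.mem_of_superset hprod ?_
  rintro ⟨X', m'⟩ ⟨h₁, h₂⟩ hc
  refine he (mem_of_le_of_mem_orthantSets hC ((hmem X' m').1 hc) fun i => ?_)
  have := h₁ i
  have := h₂ i
  simp only [Pi.sub_apply, Pi.add_apply] at *
  linarith

end RiskMeasure

theorem mainTheorem2 {Ω : Type*} [MeasurableSpace Ω] (μ : MeasureTheory.Measure Ω)
    [MeasureTheory.IsProbabilityMeasure μ] (N : ℕ) (hN : 1 ≤ N)
    (R : LInfVec μ N → Set (Fin N → ℝ))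
    (hR : RiskMeasure.IsSetValuedRiskMeasure R) (hconv : RiskMeasure.IsConvex R) :
    [RiskMeasure.IsVectorBased R, RiskMeasure.IsSeparable R,
        RiskMeasure.IsStronglySeparable R].TFAE ∧
      (RiskMeasure.IsVectorBased R → RiskMeasure.HasClosedGraph R) := by
  refine ⟨?_, RiskMeasure.IsVectorBased.hasClosedGraph⟩
  tfae_have 1 → 3 := RiskMeasure.IsVectorBased.isStronglySeparable hR
  tfae_have 3 → 2 := RiskMeasure.IsStronglySeparable.isSeparable
  tfae_have 2 → 3 := RiskMeasure.IsSeparable.isStronglySeparable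
  tfae_have 3 → 1 := RiskMeasure.IsStronglySeparable.isVectorBased
  tfae_finish
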